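/- Let $R$ be a commutative noetherian local ring of Krull dimension $d$, let $m,n\ge 0$ be integers and let $a\in R$. Write $\operatorname{mod}R$ for the category of finitely generated $R$-modules and $\operatorname{fl}R$ for its full subcategory of modules of finite length. For $s\ge 0$ let $\Omega^s(\operatorname{fl}R)$ be the full subcategory of $\operatorname{mod}R$ consisting of the modules $M$ for which there is an exact sequence $0\to M\to F_{s-1}\to\cdots\to F_0\to X\to 0$ with $X\in\operatorname{fl}R$ and each $F_j$ a direct summand of a finite direct sum of copies of $R$ (so $\Omega^0(\operatorname{fl}R)=\operatorname{fl}R$). (1) Suppose that $a\operatorname{Tor}^R_j(X,Y)=0$ for all $X\in\Omega^m(\operatorname{fl}R)$, all $Y\in\Omega^n(\operatorname{fl}R)$ and all $j>0$. Then $a^{2^{2d}}\operatorname{Tor}^R_i(M,N)=0$ for all $M,N\in\operatorname{mod}R$ and all $i>m+n+2d$. (2) Suppose that $a\operatorname{Ext}_R^j(X,Y)=0$ for all $X\in\Omega^m(\operatorname{fl}R)$, all $Y\in\Omega^n(\operatorname{fl}R)$ and all $j>0$. Then $a^{2^{2d}(n+1)}\operatorname{Ext}_R^i(M,N)=0$ for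 all $M,N\in\operatorname{mod}R$ and all $i>m$. -/

import Mathlib

open CategoryTheory

universe u

namespace SyzygyAnn

noncomputable section

/-- The category `mod R` of finitely generated `R`-modules, as a class of objects. -/
def fgMod (R : Type u) [CommRing R] : ObjectProperty (ModuleCat.{u} R) :=
  fun M => Module.Finite R M

/-- The class `fl R` of `R`-modules of finite length. -/
def fl (R : Type u) [CommRing R] : ObjectProperty (ModuleCat.{u} R) :=
  fun M => IsFiniteLength R M

/-- The class `add R` of direct summands of the finite free modules `R ^ k`. -/
def addR (R : Type u) [CommRing R] : ObjectProperty (ModuleCat.{u} R) :=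
  fun M => ∃ (k : ℕ) (s : M →ₗ[R] (Fin k → R)) (r : (Fin k → R) →ₗ[R] M), r ∘ₗ s = LinearMap.id

/-- There is an exact sequence `0 → M → F_{n-1} → ⋯ → F_0 → X → 0` with all `F_i` in `add R`.
Here `C 0 ≅ X`, `C (i + 1) = F_i` for `i < n`, `C (n + 1) ≅ M`; the terms of `C` beyond `n + 1`
play no role. For `n = 0` this says `M ≅ X`. -/
def IsSyzygy {R : Type u} [CommRing R] (n : ℕ) (M X : ModuleCat.{u} R) : Prop :=
  ∃ (C : ℕ → ModuleCat.{u} R) (δ : ∀ i, C (i + 1) →ₗ[R] C i),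
    Nonempty (C 0 ≃ₗ[R] X) ∧ Nonempty (C (n + 1) ≃ₗ[R] M) ∧
    (∀ i < n, addR R (C (i + 1))) ∧
    Function.Surjective (δ 0) ∧ Function.Injective (δ n) ∧
    ∀ i < n, Function.Exact (δ (i + 1)) (δ i)

/-- The class `Ω^n P` of finitely generated modules `M` fitting into an exact sequence
`0 → M → F_{n-1} → ⋯ → F_0 → X → 0` with `X` in `P` and all `F_i` in `add R`. -/
def syz {R : Type u} [CommRing R] (n : ℕ) (P : ObjectProperty (ModuleCat.{u} R)) :
    ObjectProperty (ModuleCat.{u} R) :=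
  fun M => fgMod R M ∧ ∃ X, P X ∧ IsSyzygy n M X

/-- The annihilator of `Tor(P, Q) = ⨁ Tor_i(X, Y)`, the sum being over all `X` in `P`, `Y` in `Q`
and `i > 0`, i.e. the intersection of the annihilators of the summands. -/
def annTor {R : Type u} [CommRing R] (P Q : ObjectProperty (ModuleCat.{u} R)) : Ideal R :=
  ⨅ (X : ModuleCat.{u} R) (_ : P X) (Y : ModuleCat.{u} R) (_ : Q Y) (i : ℕ) (_ : 0 < i),
    Module.annihilator R (((Tor (ModuleCat.{u} R) i).obj X).obj Y)

/-- The annihilator of `Ext(P, Q) = ⨁ Ext^i(X, Y)`, the sum being over all `X` in `P`, `Y` in `Q`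
and `i > 0`, i.e. the intersection of the annihilators of the summands. -/
def annExt {R : Type u} [CommRing R] (P Q : ObjectProperty (ModuleCat.{u} R)) : Ideal R :=
  ⨅ (X : ModuleCat.{u} R) (_ : P X) (Y : ModuleCat.{u} R) (_ : Q Y) (i : ℕ) (_ : 0 < i),
    Module.annihilator R (Abelian.Ext.{u} X Y i)

end

end SyzygyAnn

/-! For `x` in the maximal ideal, multiplication by `x ^ k` on `M` factors through `x ^ k M`, with
kernel and cokernel killed by `x ^ k`. If `b` kills Tor or Ext of the kernel and of the cokernel (in
suitable degrees), the two long exact sequences show that `b ^ 2` maps Tor or Ext of `M` into its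
multiples by `x ^ k`. This holds for all `k`, so Krull's intersection theorem gives that `b ^ 2`
kills it. Running through a system of parameters reduces to finite length at the cost of `d`
squarings per variable, whence `2 ^ (2 * d)`. For Tor each squaring also raises the degree bound by
one; for Ext the connecting maps go upwards and nothing is lost.

For finite length modules, dimension shifting leads to syzygies. Tor shifts in both variables by
balancedness. Ext shifts freely in the first variable; each shift in the second costs a factor `a`
to kill Ext into a free module, whence `n + 1`. -/

namespace SyzygyAnn

/-! ### Homology of `W ⊗ P` by diagram chases. -/

open TensorProduct LinearMap

/-- A resolution `⋯ → X 1 → X 0 → Y → 0` of `Y` by flat modules. -/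
structure FlatResolution {R : Type u} [CommRing R] (Y : ModuleCat.{u} R) where
  X : ℕ → ModuleCat.{u} R
  d : ∀ i, X (i + 1) →ₗ[R] X i
  ε : X 0 →ₗ[R] Y
  flat : ∀ i, Module.Flat R (X i)
  surj : Function.Surjective ε
  exact₀ : Function.Exact (d 0) ε
  exact : ∀ i, Function.Exact (d (i + 1)) (d i)

section Tensor

variable {R : Type u} [CommRing R]

/-- `b` annihilates the homology of `W ⊗ P` in degree `i + 1`. -/
def KillsHomology (b : R) (W : Type u) [AddCommGroup W] [Module R W] {P : ℕ → ModuleCat.{u} R}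
    (d : ∀ i, P (i + 1) →ₗ[R] P i) (i : ℕ) : Prop :=
  ∀ z : W ⊗[R] P (i + 1), lTensor W (d i) z = 0 → ∃ w, lTensor W (d (i + 1)) w = b • z

section Commute

variable {A B C D : Type u} [AddCommGroup A] [AddCommGroup B] [AddCommGroup C] [AddCommGroup D]
  [Module R A] [Module R B] [Module R C] [Module R D]

theorem lTensor_rTensor_apply (f : A →ₗ[R] B) (g : C →ₗ[R] D) (z : A ⊗[R] C) :
    lTensor B g (rTensor C f z) = rTensor D f (lTensor A g z) := by
  rw [← LinearMap.comp_apply, ← LinearMap.comp_apply, lTensor_comp_rTensor, rTensor_comp_lTensor]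

theorem lTensor_lTensor_eq_zero {f : A →ₗ[R] B} {g : B →ₗ[R] C} (h : Function.Exact f g)
    (W : Type u) [AddCommGroup W] [Module R W] (z : W ⊗[R] A) :
    lTensor W g (lTensor W f z) = 0 := by
  rw [← lTensor_comp_apply, h.linearMap_comp_eq_zero, lTensor_zero, LinearMap.zero_apply]

theorem rTensor_rTensor_eq_zero {f : A →ₗ[R] B} {g : B →ₗ[R] C} (h : Function.Exact f g)
    (W : Type u) [AddCommGroup W] [Module R W] (z : A ⊗[R] W) :
    rTensor W g (rTensor W f z) = 0 := by
  rw [← rTensor_comp_apply, h.linearMap_comp_eq_zero, rTensor_zero, LinearMap.zero_apply]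

end Commute

variable {K F Y : Type u} [AddCommGroup K] [AddCommGroup F] [AddCommGroup Y]
  [Module R K] [Module R F] [Module R Y] {P : ℕ → ModuleCat.{u} R}
  {d : ∀ i, P (i + 1) →ₗ[R] P i}

/-- Dimension shifting along `0 → K → F → Y → 0` with `F` flat. -/
theorem KillsHomology.of_syzygy [∀ i, Module.Flat R (P i)]
    (hd : ∀ i, Function.Exact (d (i + 1)) (d i)) {f : K →ₗ[R] F} {g : F →ₗ[R] Y}
    (hf : Function.Injective f) (hg : Function.Surjective g) (hfg : Function.Exact f g)
    [Module.Flat R F] {b : R} {i : ℕ} (h : KillsHomology b K d i) :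
    KillsHomology b Y d (i + 1) := by
  intro z hz
  obtain ⟨y, rfl⟩ := rTensor_surjective (P (i + 1 + 1)) hg z
  rw [lTensor_rTensor_apply] at hz
  obtain ⟨k, hk⟩ := (rTensor_exact (P (i + 1)) hfg hg _).1 hz
  have hk0 : lTensor K (d i) k = 0 := by
    apply Module.Flat.rTensor_preserves_injective_linearMap (M := P i) f hf
    rw [map_zero, ← lTensor_rTensor_apply, hk, lTensor_lTensor_eq_zero (hd i)]
  obtain ⟨k', hk'⟩ := h k hk0
  obtain ⟨t, ht⟩ := (Module.Flat.lTensor_exact F (hd (i + 1)) (b • y - rTensor _ f k')).1 (by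
    rw [map_sub, map_smul, ← hk, lTensor_rTensor_apply, hk', map_smul, sub_self])
  refine ⟨rTensor _ g t, ?_⟩
  rw [lTensor_rTensor_apply, ht, map_sub, rTensor_rTensor_eq_zero hfg, sub_zero, map_smul]

/-- If `b` annihilates the homology of `ker (x • ·)` in degree `i + 1` and of `M / x M` in degree
`i + 2`, then `b ^ 2` maps the homology of `M` in degree `i + 2` into its multiples by `x`. -/
theorem KillsHomology.exists_sub_eq_smul [∀ i, Module.Flat R (P i)]
    (hd : ∀ i, Function.Exact (d (i + 1)) (d i))
    (M : Type u) [AddCommGroup M] [Module R M] {x b : R} {i : ℕ}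
    (hK : KillsHomology b (ker (lsmul R M x)) d i)
    (hC : KillsHomology b (M ⧸ range (lsmul R M x)) d (i + 1))
    (z : M ⊗[R] P (i + 2)) (hz : lTensor M (d (i + 1)) z = 0) :
    ∃ (w : M ⊗[R] P (i + 3)) (c : M ⊗[R] P (i + 2)), lTensor M (d (i + 1)) c = 0 ∧
      b ^ 2 • z = lTensor M (d (i + 2)) w + x • c := by
  set φ := lsmul R M x
  have hB : Function.Exact (range φ).subtype (range φ).mkQ :=
    exact_subtype_mkQ _
  have hinj : Function.Injective (range φ).subtype := Subtype.val_injective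
  have hKe : Function.Exact (ker φ).subtype φ.rangeRestrict := by
    rw [exact_iff, ker_rangeRestrict, Submodule.range_subtype]
  obtain ⟨w, hw⟩ := hC (rTensor _ (range φ).mkQ z) (by
    rw [lTensor_rTensor_apply, hz, map_zero])
  obtain ⟨w, rfl⟩ := rTensor_surjective (P (i + 1 + 1 + 1)) (Submodule.mkQ_surjective _) w
  obtain ⟨z', hz'⟩ := (rTensor_exact (P (i + 2)) hB (Submodule.mkQ_surjective _)
    (b • z - lTensor M (d (i + 2)) w)).1 (by
      rw [map_sub, map_smul, ← hw, lTensor_rTensor_apply, sub_self])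
  have hz'0 : lTensor (range φ) (d (i + 1)) z' = 0 := by
    apply Module.Flat.rTensor_preserves_injective_linearMap (M := P (i + 1)) _ hinj
    rw [map_zero, ← lTensor_rTensor_apply, hz', map_sub, map_smul, hz,
      lTensor_lTensor_eq_zero (hd (i + 1)), smul_zero, sub_zero]
  obtain ⟨y, rfl⟩ := rTensor_surjective (P (i + 2)) φ.surjective_rangeRestrict z'
  rw [lTensor_rTensor_apply] at hz'0
  -- The class of `k` is the image of that of `z'` under the connecting map, so the kernel matters
  -- one degree lower.
  obtain ⟨k, hk⟩ := (rTensor_exact (P (i + 1)) hKe φ.surjective_rangeRestrict _).1 hz'0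
  obtain ⟨k', hk'⟩ := hK k (by
    apply Module.Flat.rTensor_preserves_injective_linearMap (M := P i) (ker φ).subtype
      Subtype.val_injective
    rw [map_zero, ← lTensor_rTensor_apply, hk, lTensor_lTensor_eq_zero (hd i)])
  have hφ : ∀ c : M ⊗[R] P (i + 2),
      rTensor _ (range φ).subtype (rTensor _ φ.rangeRestrict c) = x • c := by
    intro c
    rw [← rTensor_comp_apply, show (range φ).subtype ∘ₗ φ.rangeRestrict = x • LinearMap.id from rfl,
      rTensor_smul, rTensor_id]
    rfl
  refine ⟨b • w, b • y - rTensor _ (ker φ).subtype k', ?_, ?_⟩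
  · rw [map_sub, map_smul, ← hk, lTensor_rTensor_apply, hk', map_smul, sub_self]
  · rw [← hφ, map_sub, rTensor_rTensor_eq_zero hKe, sub_zero, map_smul, map_smul, map_smul, hz',
      smul_sub, pow_two, mul_smul]
    abel

/-- Shifting a flat resolution by one degree. -/
def FlatResolution.shift {Y : ModuleCat.{u} R} (P : FlatResolution Y) :
    FlatResolution (ModuleCat.of R (ker P.ε)) where
  X i := P.X (i + 1)
  d i := P.d (i + 1)
  ε := (P.d 0).codRestrict _ fun x ↦ P.exact₀.apply_apply_eq_zero x
  flat i := P.flat (i + 1)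
  surj := by
    rintro ⟨y, hy⟩
    obtain ⟨x, rfl⟩ := (P.exact₀ y).1 hy
    exact ⟨x, rfl⟩
  exact₀ := by
    intro x
    rw [← P.exact 0 x]
    exact Subtype.ext_iff
  exact i := P.exact (i + 1)

/-- A zigzag through the double complex `P ⊗ Q`, from `Y ⊗ Q` by way of `P 0 ⊗ Q` and `P 1 ⊗ Q` to
`P ⊗ X`, and back after multiplying by `b`. -/
theorem KillsHomology.swap_zero {X Y : ModuleCat.{u} R} (P : FlatResolution Y)
    (Q : FlatResolution X) {b : R} (h : KillsHomology b X P.d 0) : KillsHomology b Y Q.d 0 := by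
  have hcomm : ∀ (A B : ModuleCat.{u} R) (f : A →ₗ[R] B) (z : A ⊗[R] X),
      lTensor X f (TensorProduct.comm R _ _ z) = TensorProduct.comm R _ _ (rTensor X f z) :=
    fun A B f z ↦ (congr($(comm_comp_rTensor_comp_comm_eq f) (TensorProduct.comm R _ _ z))).symm.trans
      (by simp)
  intro z hz
  obtain ⟨y, rfl⟩ := rTensor_surjective (Q.X (0 + 1)) P.surj z
  rw [lTensor_rTensor_apply] at hz
  obtain ⟨w, hw⟩ := (rTensor_exact (Q.X 0) P.exact₀ P.surj _).1 hz
  obtain ⟨v, hv⟩ := h (TensorProduct.comm R _ _ (lTensor _ Q.ε w)) (by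
    rw [hcomm, ← lTensor_rTensor_apply, hw, lTensor_lTensor_eq_zero Q.exact₀, map_zero])
  obtain ⟨v, rfl⟩ := (TensorProduct.comm R _ _).surjective v
  obtain ⟨v, rfl⟩ := lTensor_surjective (P.X (0 + 1 + 1)) Q.surj v
  rw [hcomm, ← map_smul, EmbeddingLike.apply_eq_iff_eq] at hv
  obtain ⟨s, hs⟩ := (lTensor_exact (P.X (0 + 1)) Q.exact₀ Q.surj
    (b • w - rTensor _ (P.d (0 + 1)) v)).1 (by
      rw [map_sub, map_smul, ← hv, lTensor_rTensor_apply, sub_self])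
  have := P.flat 0
  obtain ⟨t, ht⟩ := (Module.Flat.lTensor_exact (P.X 0) (Q.exact 0)
    (b • y - rTensor _ (P.d 0) s)).1 (by
      rw [map_sub, map_smul, lTensor_rTensor_apply, hs, map_sub, map_smul,
        rTensor_rTensor_eq_zero (P.exact 0), hw, sub_zero, sub_self])
  refine ⟨rTensor _ P.ε t, ?_⟩
  rw [lTensor_rTensor_apply, ht, map_sub, rTensor_rTensor_eq_zero P.exact₀, sub_zero, map_smul]

/-- `Tor` is balanced: the homology of `X ⊗ P` and of `Y ⊗ Q` have the same annihilator. -/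
theorem KillsHomology.swap {X Y : ModuleCat.{u} R} (P : FlatResolution Y)
    (Q : FlatResolution X) {b : R} {i : ℕ} (h : KillsHomology b X P.d i) :
    KillsHomology b Y Q.d i := by
  induction i generalizing Y with
  | zero => exact h.swap_zero P Q
  | succ i ih =>
    have := P.flat 0
    have := Q.flat
    exact (ih P.shift h).of_syzygy (K := ker P.ε) Q.exact Subtype.val_injective P.surj
      (by rw [exact_iff, Submodule.range_subtype])

end Tensor

/-! ### Finite resolutions and Krull's intersection theorem. -/

section Noetherian

variable {R : Type u} [CommRing R]

/-- A finite free cover of a finitely generated module. -/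
theorem exists_finite_free_cover (Y : ModuleCat.{u} R) (hY : fgMod R Y) :
    ∃ (k : ℕ) (f : (Fin k → R) →ₗ[R] Y), Function.Surjective f := by
  have : Module.Finite R Y := hY
  exact Module.Finite.exists_fin' R Y

variable [IsNoetherianRing R]

theorem fgMod_ker {k : ℕ} {Y : ModuleCat.{u} R} (f : (Fin k → R) →ₗ[R] Y) :
    fgMod R (ModuleCat.of R (ker f)) :=
  inferInstanceAs (Module.Finite R (ker f))

/-- The iterated kernels of chosen finite free covers. -/
noncomputable def iteratedSyzygy (Y : {Y : ModuleCat.{u} R // fgMod R Y}) :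
    ℕ → {Y : ModuleCat.{u} R // fgMod R Y}
  | 0 => Y
  | i + 1 => ⟨_, fgMod_ker (exists_finite_free_cover (iteratedSyzygy Y i).1
      (iteratedSyzygy Y i).2).choose_spec.choose⟩

theorem exists_finite_flatResolution (Y : ModuleCat.{u} R) (hY : fgMod R Y) :
    ∃ P : FlatResolution Y, ∀ i, fgMod R (P.X i) := by
  let S := iteratedSyzygy ⟨Y, hY⟩
  let k i : ℕ := (exists_finite_free_cover (S i).1 (S i).2).choose
  let f i : (Fin (k i) → R) →ₗ[R] (S i).1 :=
    (exists_finite_free_cover (S i).1 (S i).2).choose_spec.choose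
  have hf i : Function.Surjective (f i) :=
    (exists_finite_free_cover (S i).1 (S i).2).choose_spec.choose_spec
  let ι i : (S (i + 1)).1 →ₗ[R] (Fin (k i) → R) := (ker (f i)).subtype
  have hι i : Function.Injective (ι i) := Subtype.val_injective
  have hιf i : Function.Exact (ι i) (f i) := by
    rw [exact_iff]; exact (Submodule.range_subtype _).symm
  have h₀ : Function.Exact (ι 0 ∘ₗ f 1) (f 0) := (hf 1).comp_exact_iff_exact.2 (hιf 0)
  let P : FlatResolution Y :=
    { X i := ModuleCat.of R (Fin (k i) → R)
      d i := ι i ∘ₗ f (i + 1)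
      ε := f 0
      flat i := inferInstanceAs (Module.Flat R (Fin (k i) → R))
      surj := hf 0
      exact₀ := h₀
      exact i := (hf (i + 2)).comp_exact_iff_exact.2 <|
        (hι i).comp_exact_iff_exact.2 (hιf (i + 1)) }
  exact ⟨P, fun i ↦ inferInstanceAs (Module.Finite R (Fin (k i) → R))⟩

/-- A consequence of Krull's intersection theorem. -/
theorem smul_eq_zero_of_forall_exists_pow_smul [IsLocalRing R] {T : Type*} [AddCommGroup T]
    [Module R T] [Module.Finite R T] {x : R} (hx : x ∈ IsLocalRing.maximalIdeal R) {t : T}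
    (h : ∀ k : ℕ, ∃ c : T, t = x ^ k • c) : t = 0 := by
  have := Ideal.iInf_pow_smul_eq_bot_of_isLocalRing (M := T) _
    (IsLocalRing.maximalIdeal.isMaximal R).ne_top
  rw [← Submodule.mem_bot R, ← this, Submodule.mem_iInf]
  intro k
  obtain ⟨c, rfl⟩ := h k
  exact Submodule.smul_mem_smul (Ideal.pow_mem_pow hx k) trivial

/-- The homology `Z / B` is finitely generated, and the class of `b ^ 2 • z` is divisible by every
power of `x`. -/
theorem KillsHomology.sq_of_forall_pow [IsLocalRing R] {P : ℕ → ModuleCat.{u} R}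
    {d : ∀ i, P (i + 1) →ₗ[R] P i} [∀ i, Module.Flat R (P i)] [∀ i, Module.Finite R (P i)]
    (hd : ∀ i, Function.Exact (d (i + 1)) (d i)) (M : Type u) [AddCommGroup M] [Module R M]
    [Module.Finite R M] {x b : R} (hx : x ∈ IsLocalRing.maximalIdeal R) {i : ℕ}
    (hK : ∀ k : ℕ, KillsHomology b (ker (lsmul R M (x ^ k))) d i)
    (hC : ∀ k : ℕ, KillsHomology b (M ⧸ range (lsmul R M (x ^ k))) d (i + 1)) :
    KillsHomology (b ^ 2) M d (i + 1) := by
  intro z hz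
  let Z := ker (lTensor M (d (i + 1)))
  let B := (range (lTensor M (d (i + 1 + 1)))).comap Z.subtype
  have : B.mkQ (b ^ 2 • ⟨z, hz⟩) = 0 := by
    refine smul_eq_zero_of_forall_exists_pow_smul hx fun k ↦ ?_
    obtain ⟨w, c, hc, h⟩ := KillsHomology.exists_sub_eq_smul hd M (hK k) (hC k) z hz
    refine ⟨B.mkQ ⟨c, hc⟩, ?_⟩
    rw [← map_smul, ← sub_eq_zero, ← map_sub, Submodule.mkQ_apply, Submodule.Quotient.mk_eq_zero]
    exact ⟨w, (sub_eq_of_eq_add h).symm⟩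
  rw [Submodule.mkQ_apply, Submodule.Quotient.mk_eq_zero] at this
  exact this

end Noetherian

end SyzygyAnn

/-! ### Passage to the derived functor Tor. -/

namespace SyzygyAnn

open TensorProduct LinearMap

variable {R : Type u} [CommRing R]

/-- An element annihilates the homology of a short complex of modules if and only if it maps
cycles to boundaries. -/
theorem forall_smul_homology_eq_zero_iff (S : ShortComplex (ModuleCat.{u} R)) (b : R) :
    (∀ t : S.homology, b • t = 0) ↔
      ∀ z : S.X₂, S.g.hom z = 0 → ∃ w : S.X₁, S.f.hom w = b • z := by
  let e : S.homology ≃ₗ[R] (ker S.g.hom ⧸ range S.moduleCatToCycles) :=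
    S.moduleCatHomologyIso.toLinearEquiv
  have key : (∀ t : S.homology, b • t = 0) ↔
      ∀ t : ker S.g.hom ⧸ range S.moduleCatToCycles, b • t = 0 := by
    constructor
    · intro h t
      apply e.symm.injective
      rw [map_smul, h, map_zero]
    · intro h t
      apply e.injective
      rw [map_smul, h, map_zero]
  rw [key]
  constructor
  · intro h z hz
    have := h (Submodule.Quotient.mk ⟨z, hz⟩)
    rw [← Submodule.Quotient.mk_smul, Submodule.Quotient.mk_eq_zero] at this
    obtain ⟨w, hw⟩ := this
    exact ⟨w, congr($(hw).1)⟩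
  · intro h t
    obtain ⟨⟨z, hz⟩, rfl⟩ := Submodule.Quotient.mk_surjective _ t
    obtain ⟨w, hw⟩ := h z hz
    rw [← Submodule.Quotient.mk_smul, Submodule.Quotient.mk_eq_zero]
    exact ⟨w, Subtype.ext hw⟩

/-- `b` annihilates `Tor_i(X, Y)`. -/
def KillsTor (b : R) (i : ℕ) (X Y : ModuleCat.{u} R) : Prop :=
  ∀ t : ((Tor (ModuleCat.{u} R) i).obj X).obj Y, b • t = 0

/-- The flat resolution underlying a projective resolution. -/
noncomputable def FlatResolution.ofProjective {Y : ModuleCat.{u} R} (P : ProjectiveResolution Y) :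
    FlatResolution Y where
  X i := P.complex.X i
  d i := (P.complex.d (i + 1) i).hom
  ε := (P.π.f 0).hom
  flat i := by
    have : Module.Projective R (P.complex.X i) :=
      (IsProjective.iff_projective _).2 (P.projective i)
    infer_instance
  surj := (ModuleCat.epi_iff_surjective _).1 inferInstance
  exact₀ := (ShortComplex.ShortExact.moduleCat_exact_iff_function_exact _).1
    (ShortComplex.exact_of_g_is_cokernel
      (.mk (P.complex.d 1 0) (P.π.f 0) P.complex_d_comp_π_f_zero) P.isColimitCokernelCofork)
  exact i := (ShortComplex.ShortExact.moduleCat_exact_iff_function_exact _).1 (P.exact_succ i)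

theorem killsTor_iff_ofProjective (b : R) (i : ℕ) (X Y : ModuleCat.{u} R)
    (P : ProjectiveResolution Y) :
    KillsTor b (i + 1) X Y ↔ KillsHomology b X (FlatResolution.ofProjective P).d i := by
  let K := (((MonoidalCategory.tensoringLeft (ModuleCat.{u} R)).obj X).mapHomologicalComplex _).obj P.complex
  let e : ((Tor (ModuleCat.{u} R) (i + 1)).obj X).obj Y ≅ (K.sc' (i + 2) (i + 1) i).homology :=
    P.isoLeftDerivedObj ((MonoidalCategory.tensoringLeft (ModuleCat.{u} R)).obj X) (i + 1) ≪≫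
    ShortComplex.homologyMapIso (K.isoSc' (i + 2) (i + 1) i (by simp) (by simp))
  have : KillsTor b (i + 1) X Y ↔ ∀ t : (K.sc' (i + 2) (i + 1) i).homology, b • t = 0 := by
    constructor
    · intro h t
      apply e.toLinearEquiv.symm.injective
      rw [map_smul, h, map_zero]
    · intro h t
      apply e.toLinearEquiv.injective
      rw [map_smul, h, map_zero]
  rw [this, forall_smul_homology_eq_zero_iff]
  rfl

theorem KillsTor.symm {b : R} {i : ℕ} {X Y : ModuleCat.{u} R} (h : KillsTor b (i + 1) X Y) :
    KillsTor b (i + 1) Y X := by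
  rw [killsTor_iff_ofProjective _ _ _ _ (projectiveResolution _)] at h ⊢
  exact h.swap _ _

/-- Swapping to a resolution of `X` and back replaces one resolution of `Y` by another. A resolution
by finitely generated modules thus becomes available for Krull's theorem. -/
theorem killsTor_iff (b : R) (i : ℕ) (X : ModuleCat.{u} R) {Y : ModuleCat.{u} R}
    (P : FlatResolution Y) :
    KillsTor b (i + 1) X Y ↔ KillsHomology b X P.d i := by
  rw [killsTor_iff_ofProjective _ _ _ _ (projectiveResolution _)]
  constructor <;> intro h <;>
    exact (h.swap _ (.ofProjective (projectiveResolution X))).swap _ _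

theorem KillsTor.of_syzygy {K F X : ModuleCat.{u} R} {f : K →ₗ[R] F} {g : F →ₗ[R] X}
    (hf : Function.Injective f) (hg : Function.Surjective g) (hfg : Function.Exact f g)
    [Module.Flat R F] {b : R} {i : ℕ} {Y : ModuleCat.{u} R} (h : KillsTor b (i + 1) K Y) :
    KillsTor b (i + 2) X Y := by
  let P := FlatResolution.ofProjective (projectiveResolution Y)
  have := P.flat
  rw [killsTor_iff _ _ _ P] at h ⊢
  exact h.of_syzygy P.exact hf hg hfg

theorem KillsTor.sq_of_forall_pow [IsNoetherianRing R] [IsLocalRing R] {M N : ModuleCat.{u} R}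
    (hM : fgMod R M) (hN : fgMod R N) {x b : R} (hx : x ∈ IsLocalRing.maximalIdeal R) {i : ℕ}
    (hK : ∀ k : ℕ, KillsTor b (i + 1) (ModuleCat.of R (ker (lsmul R M (x ^ k)))) N)
    (hC : ∀ k : ℕ, KillsTor b (i + 2) (ModuleCat.of R (M ⧸ range (lsmul R M (x ^ k)))) N) :
    KillsTor (b ^ 2) (i + 2) M N := by
  obtain ⟨P, hP⟩ := exists_finite_flatResolution N hN
  have := P.flat
  have : ∀ i, Module.Finite R (P.X i) := hP
  have : Module.Finite R M := hM
  simp only [killsTor_iff _ _ _ P] at hK hC ⊢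
  exact KillsHomology.sq_of_forall_pow P.exact M hx hK hC

end SyzygyAnn

/-! ### Syzygies and induction along a system of parameters. -/

namespace SyzygyAnn

open LinearMap IsLocalRing

variable {R : Type u} [CommRing R]

section Syzygy

theorem isSyzygy_zero (X : ModuleCat.{u} R) : IsSyzygy 0 X X :=
  ⟨fun _ ↦ X, fun _ ↦ LinearMap.id, ⟨.refl R X⟩, ⟨.refl R X⟩, by simp, Function.surjective_id,
    Function.injective_id, by simp⟩

theorem IsSyzygy.succ {n : ℕ} {M K F X : ModuleCat.{u} R} {f : K →ₗ[R] F} {g : F →ₗ[R] X}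
    (hf : Function.Injective f) (hg : Function.Surjective g) (hfg : Function.Exact f g)
    (hF : addR R F) (h : IsSyzygy n M K) : IsSyzygy (n + 1) M X := by
  obtain ⟨C, δ, ⟨e⟩, ⟨e'⟩, hC, hsurj, hinj, hex⟩ := h
  let C' : ℕ → ModuleCat.{u} R
    | 0 => X
    | 1 => F
    | i + 2 => C (i + 1)
  let δ₁ : C 1 →ₗ[R] F := f ∘ₗ e.toLinearMap ∘ₗ δ 0
  have hfe : Function.Injective (f ∘ₗ e.toLinearMap) := hf.comp e.injective
  let δ' : ∀ i, C' (i + 1) →ₗ[R] C' i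
    | 0 => g
    | 1 => δ₁
    | i + 2 => δ (i + 1)
  refine ⟨C', δ', ⟨.refl R X⟩, ⟨e'⟩, ?_, hg, ?_, ?_⟩
  · rintro (_ | i) hi
    · exact hF
    · exact hC i (by omega)
  · cases n with
    | zero => exact hfe.comp hinj
    | succ n => exact hinj
  · rintro (_ | _ | i) hi
    · change Function.Exact (f ∘ₗ e.toLinearMap ∘ₗ δ 0) g
      rw [(e.surjective.comp hsurj).comp_exact_iff_exact (p := e.toLinearMap ∘ₗ δ 0)]
      exact hfg
    · change Function.Exact (δ 1) ((f ∘ₗ e.toLinearMap) ∘ₗ δ 0)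
      rw [hfe.comp_exact_iff_exact]
      exact hex 0 (by omega)
    · exact hex (i + 1) (by omega)

theorem addR_pi (k : ℕ) : addR R (ModuleCat.of R (Fin k → R)) :=
  ⟨k, LinearMap.id, LinearMap.id, rfl⟩

theorem addR_punit : addR R (ModuleCat.of R PUnit.{u + 1}) :=
  ⟨0, 0, 0, LinearMap.ext fun _ ↦ rfl⟩

theorem addR_self : addR R (ModuleCat.of R R) :=
  ⟨1, LinearMap.pi fun _ ↦ LinearMap.id, LinearMap.proj 0, rfl⟩

theorem isSyzygy_self_punit (n : ℕ) :
    IsSyzygy (n + 1) (ModuleCat.of R R) (ModuleCat.of R PUnit.{u + 1}) := by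
  induction n with
  | zero =>
    refine (isSyzygy_zero _).succ (F := ModuleCat.of R R) (f := LinearMap.id) (g := 0)
      Function.injective_id (fun _ ↦ ⟨0, rfl⟩) (fun x ↦ ?_) addR_self
    exact ⟨fun _ ↦ ⟨x, rfl⟩, fun _ ↦ rfl⟩
  | succ n ih =>
    refine ih.succ (F := ModuleCat.of R PUnit.{u + 1}) (f := 0) (g := LinearMap.id)
      (fun _ _ _ ↦ rfl) Function.surjective_id (fun x ↦ ?_) addR_punit
    exact ⟨fun _ ↦ ⟨x, rfl⟩, fun _ ↦ rfl⟩

/-- `R` is a positive syzygy of the zero module. Hence, for `n > 0`, the hypothesis on Ext also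
covers free second arguments. -/
theorem syz_self (n : ℕ) : syz (n + 1) (fl R) (ModuleCat.of R R) :=
  ⟨inferInstanceAs (Module.Finite R R), _, .of_subsingleton, isSyzygy_self_punit n⟩

theorem fgMod_of_fl {X : ModuleCat.{u} R} (hX : fl R X) : fgMod R X := by
  have := (isFiniteLength_iff_isNoetherian_isArtinian.1 hX).1
  exact inferInstanceAs (Module.Finite R X)

/-- Every finitely generated module has an `n`-th syzygy, and a property passes from it to the
module when it passes up along finite free covers. -/
theorem exists_isSyzygy [IsNoetherianRing R] (n : ℕ) (X : ModuleCat.{u} R) (hX : fgMod R X) :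
    ∃ M : ModuleCat.{u} R, fgMod R M ∧ IsSyzygy n M X ∧
      ∀ Q : ℕ → ModuleCat.{u} R → Prop,
        (∀ (i k : ℕ) (K Y : ModuleCat.{u} R) (f : K →ₗ[R] ModuleCat.of R (Fin k → R))
          (g : ModuleCat.of R (Fin k → R) →ₗ[R] Y), Function.Injective f →
          Function.Surjective g → Function.Exact f g → Q i K → Q (i + 1) Y) →
        ∀ i, Q i M → Q (i + n) X := by
  induction n generalizing X with
  | zero => exact ⟨X, hX, isSyzygy_zero X, fun _ _ _ h ↦ h⟩
  | succ n ih =>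
    obtain ⟨k, g, hg⟩ := exists_finite_free_cover X hX
    obtain ⟨M, hM, hMX, H⟩ := ih _ (fgMod_ker g)
    have hex : Function.Exact (ker g).subtype g := by rw [exact_iff, Submodule.range_subtype]
    exact ⟨M, hM, hMX.succ (F := ModuleCat.of R (Fin k → R)) Subtype.val_injective hg hex
      (addR_pi k), fun Q hQ i h ↦ hQ _ k (ModuleCat.of R (ker g)) X _ g Subtype.val_injective hg
      hex (H Q hQ i h)⟩

end Syzygy

section Induction

variable [IsNoetherianRing R] [IsLocalRing R]

/-- A finitely generated module on which each member of a system of parameters is nilpotent has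
finite length. -/
theorem isFiniteLength_of_pow_smul_eq_zero {s : Set R}
    (hs : maximalIdeal R ∈ (Ideal.span s).minimalPrimes) (M : Type*) [AddCommGroup M] [Module R M]
    [Module.Finite R M] (h : ∀ y ∈ s, ∃ k : ℕ, ∀ z : M, y ^ k • z = 0) : IsFiniteLength R M := by
  rcases subsingleton_or_nontrivial M with _ | _
  · exact .of_subsingleton
  set I := Module.annihilator R M
  have hsI : Ideal.span s ≤ I.radical := Ideal.span_le.2 fun y hy ↦ by
    obtain ⟨k, hk⟩ := h y hy
    exact ⟨k, Module.mem_annihilator.2 hk⟩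
  have hI : I ≠ ⊤ := fun h ↦ not_subsingleton M (Module.annihilator_eq_top_iff.1 h)
  -- A prime over `I` contains `s`, so minimality over `s` forces it to be maximal; hence `R ⧸ I` is
  -- artinian.
  have hm : maximalIdeal R ∈ I.minimalPrimes :=
    ⟨⟨(maximalIdeal.isMaximal R).isPrime, le_maximalIdeal hI⟩, fun p hp hpm ↦
      hs.2 ⟨hp.1, hsI.trans (hp.1.radical_le_iff.2 hp.2)⟩ hpm⟩
  have := quotient_artinian_of_mem_minimalPrimes_of_isLocalRing I hm
  let : Module (R ⧸ I) M := Module.quotientAnnihilator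
  have : IsScalarTower R (R ⧸ I) M := .of_algebraMap_smul fun _ _ ↦ rfl
  have : Module.Finite (R ⧸ I) M := .of_restrictScalars_finite R _ _
  have : IsArtinian R M :=
    isArtinian_of_surjective_algebraMap (R := R ⧸ I) Ideal.Quotient.mk_surjective
  exact isFiniteLength_iff_isNoetherian_isArtinian.2 ⟨inferInstance, this⟩

/-- A property indexed by an element of `R`, which holds for `a` on modules of finite length and
passes to a module from the kernels and cokernels of powers of a nonunit at the cost of squaring
the element, holds for `a ^ 2 ^ d` on all finitely generated modules. -/
theorem induction_systemOfParameters {d : ℕ} (hd : ringKrullDim R = d)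
    (Q : ℕ → R → ModuleCat.{u} R → Prop) {a : R}
    (base : ∀ M : ModuleCat.{u} R, fl R M → Q 0 a M)
    (step : ∀ (r : ℕ) (b : R) (M : ModuleCat.{u} R), fgMod R M → ∀ x ∈ maximalIdeal R,
      (∀ k : ℕ, Q r b (ModuleCat.of R (ker (lsmul R M (x ^ k))))) →
      (∀ k : ℕ, Q r b (ModuleCat.of R (M ⧸ range (lsmul R M (x ^ k))))) → Q (r + 1) (b ^ 2) M)
    (M : ModuleCat.{u} R) (hM : fgMod R M) : Q d (a ^ 2 ^ d) M := by
  classical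
  obtain ⟨s, hs, hcard⟩ :=
    (maximalIdeal R).exists_finset_card_eq_height_of_isNoetherianRing
  rw [← maximalIdeal_height_eq_ringKrullDim, ← hcard] at hd
  obtain rfl : s.card = d := by exact_mod_cast hd
  have hsm : ∀ x ∈ s, x ∈ maximalIdeal R := fun x hx ↦ hs.1.2 (Ideal.subset_span hx)
  -- `l` collects the parameters not yet known to act nilpotently on `M`.
  suffices ∀ l ⊆ s, ∀ M : ModuleCat.{u} R, fgMod R M →
      (∀ y ∈ s \ l, ∃ k : ℕ, ∀ z : M, y ^ k • z = 0) → Q l.card (a ^ 2 ^ l.card) M from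
    this s subset_rfl M hM fun y hy ↦ absurd hy
      (by rw [Finset.sdiff_self]; exact Finset.notMem_empty y)
  intro l
  induction l using Finset.induction_on with
  | empty =>
    intro _ M hM h
    have : Module.Finite R M := hM
    rw [Finset.card_empty, pow_zero, pow_one]
    exact base M (isFiniteLength_of_pow_smul_eq_zero hs M fun y hy ↦
      h y (by rwa [Finset.sdiff_empty]))
  | insert x l hx ih =>
    intro hl M hM h
    have : Module.Finite R M := hM
    rw [Finset.card_insert_of_notMem hx, pow_succ 2, pow_mul]
    have hl' : l ⊆ s := (Finset.subset_insert x l).trans hl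
    refine step _ _ M hM x (hsm x (hl (Finset.mem_insert_self x l))) (fun k ↦ ?_) fun k ↦ ?_
    · refine ih hl' _ (inferInstanceAs (Module.Finite R (ker (lsmul R M (x ^ k))))) fun y hy ↦ ?_
      by_cases hyx : y = x
      · subst hyx
        exact ⟨k, fun z ↦ Subtype.ext z.2⟩
      · obtain ⟨j, hj⟩ := h y (by
          simp only [Finset.mem_sdiff, Finset.mem_insert] at hy ⊢
          tauto)
        exact ⟨j, fun z ↦ Subtype.ext (hj z.1)⟩
    · refine ih hl' _ (inferInstanceAs (Module.Finite R (M ⧸ range (lsmul R M (x ^ k)))))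
        fun y hy ↦ ?_
      by_cases hyx : y = x
      · subst hyx
        refine ⟨k, fun z ↦ ?_⟩
        obtain ⟨z, rfl⟩ := Submodule.Quotient.mk_surjective _ z
        rw [← Submodule.Quotient.mk_smul, Submodule.Quotient.mk_eq_zero]
        exact ⟨z, rfl⟩
      · obtain ⟨j, hj⟩ := h y (by
          simp only [Finset.mem_sdiff, Finset.mem_insert] at hy ⊢
          tauto)
        refine ⟨j, fun z ↦ ?_⟩
        obtain ⟨z, rfl⟩ := Submodule.Quotient.mk_surjective _ z
        rw [← Submodule.Quotient.mk_smul, hj, Submodule.Quotient.mk_zero]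

end Induction

end SyzygyAnn

/-! ### Dimension shifting and Krull's argument for Ext. -/

namespace SyzygyAnn

open LinearMap IsLocalRing Abelian

variable {R : Type u} [CommRing R]

/-- The short exact sequence of `ModuleCat R` given by an exact sequence of linear maps. -/
theorem exists_shortExact {K F Y : ModuleCat.{u} R} {f : K →ₗ[R] F} {g : F →ₗ[R] Y}
    (hf : Function.Injective f) (hg : Function.Surjective g) (hfg : Function.Exact f g) :
    ∃ h : ModuleCat.ofHom f ≫ ModuleCat.ofHom g = 0,
      (ShortComplex.mk (ModuleCat.ofHom f) (ModuleCat.ofHom g) h).ShortExact :=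
  ⟨ModuleCat.hom_ext hfg.linearMap_comp_eq_zero, ModuleCat.shortComplex_shortExact _ hfg hf hg⟩

/-- `b` annihilates `Ext^i(X, Y)`. -/
def KillsExt (b : R) (i : ℕ) (X Y : ModuleCat.{u} R) : Prop :=
  ∀ e : Ext.{u} X Y i, b • e = 0

theorem KillsExt.of_syzygy {K X : ModuleCat.{u} R} {k : ℕ}
    {f : K →ₗ[R] ModuleCat.of R (Fin k → R)} {g : ModuleCat.of R (Fin k → R) →ₗ[R] X}
    (hf : Function.Injective f) (hg : Function.Surjective g) (hfg : Function.Exact f g)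
    {b : R} {i : ℕ} {Y : ModuleCat.{u} R} (h : KillsExt b i K Y) :
    KillsExt b (i + 1) X Y := by
  intro e
  obtain ⟨_, hS⟩ := exists_shortExact hf hg hfg
  have : Projective (ModuleCat.of R (Fin k → R)) :=
    (IsProjective.iff_projective _).1 inferInstance
  obtain ⟨e, rfl⟩ := precomp_extClass_surjective_of_projective_X₂ Y hS i e
  change b • hS.extClass.comp e (add_comm 1 i) = 0
  rw [← Ext.comp_smul, h e, Ext.comp_zero]

theorem KillsExt.pi {X : ModuleCat.{u} R} {b : R} {i : ℕ}
    (h : KillsExt b i X (ModuleCat.of R R)) (k : ℕ) :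
    KillsExt b i X (ModuleCat.of R (Fin k → R)) := by
  intro e
  have hid : 𝟙 (ModuleCat.of R (Fin k → R)) = ∑ j : Fin k,
      ModuleCat.ofHom (proj (R := R) (φ := fun _ : Fin k ↦ R) j) ≫
        ModuleCat.ofHom (single R (fun _ : Fin k ↦ R) j) := by
    ext1
    rw [ModuleCat.hom_sum]
    refine LinearMap.ext fun v ↦ ?_
    rw [LinearMap.sum_apply]
    exact (Finset.univ_sum_single v).symm
  rw [← Ext.comp_mk₀_id e, hid, Ext.mk₀_sum, Ext.comp_sum, Finset.smul_sum]
  refine Finset.sum_eq_zero fun j _ ↦ ?_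
  rw [← Ext.mk₀_comp_mk₀, ← Ext.comp_assoc_of_third_deg_zero, ← Ext.smul_comp, h, Ext.zero_comp]

/-- `Ext^i(X, Y)` lies between `Ext^i(X, F)` and `Ext^(i+1)(X, K)` in the long exact sequence. -/
theorem KillsExt.mul_of_exact {K F Y X : ModuleCat.{u} R} {f : K →ₗ[R] F} {g : F →ₗ[R] Y}
    (hf : Function.Injective f) (hg : Function.Surjective g) (hfg : Function.Exact f g)
    {b c : R} {i : ℕ} (hF : KillsExt c i X F) (hK : KillsExt b (i + 1) X K) :
    KillsExt (c * b) i X Y := by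
  intro e
  obtain ⟨_, hS⟩ := exists_shortExact hf hg hfg
  obtain ⟨e', he'⟩ := Ext.covariant_sequence_exact₃ X hS (b • e) rfl (by
    rw [Ext.smul_comp, hK])
  rw [mul_smul, ← he', ← Ext.smul_comp, hF, Ext.zero_comp]

theorem exists_shortExact_lsmul (M : ModuleCat.{u} R) (x : R) :
    ∃ (B : ModuleCat.{u} R) (p : M ⟶ B) (j : B ⟶ M)
      (h₁ : ModuleCat.ofHom (ker (lsmul R M x)).subtype ≫ p = 0)
      (h₂ : j ≫ ModuleCat.ofHom (range (lsmul R M x)).mkQ = 0),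
      p ≫ j = x • 𝟙 M ∧ (ShortComplex.mk _ _ h₁).ShortExact ∧
        (ShortComplex.mk _ _ h₂).ShortExact := by
  obtain ⟨h₁, h₁'⟩ := exists_shortExact (K := ModuleCat.of R (ker (lsmul R M x))) (F := M)
    (Y := ModuleCat.of R (range (lsmul R M x))) (f := (ker (lsmul R M x)).subtype)
    (g := (lsmul R M x).rangeRestrict) Subtype.val_injective (surjective_rangeRestrict _)
    (by rw [exact_iff, ker_rangeRestrict, Submodule.range_subtype])
  obtain ⟨h₂, h₂'⟩ := exists_shortExact (K := ModuleCat.of R (range (lsmul R M x))) (F := M)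
    (Y := ModuleCat.of R (M ⧸ range (lsmul R M x))) (f := (range (lsmul R M x)).subtype)
    (g := (range (lsmul R M x)).mkQ) Subtype.val_injective (Submodule.mkQ_surjective _)
    (exact_subtype_mkQ _)
  exact ⟨_, _, _, h₁, h₂, rfl, h₁', h₂'⟩

variable [IsNoetherianRing R] [IsLocalRing R]

/-- `b • e` dies on the kernel, so it comes from `v` on the image `B`. The obstruction to extending
`b • v` to `M` lies in Ext of the cokernel, one degree higher. -/
theorem KillsExt.sq_of_forall_pow_left {M N : ModuleCat.{u} R} (hM : fgMod R M) (hN : fgMod R N)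
    {x b : R} (hx : x ∈ maximalIdeal R) {i : ℕ}
    (hK : ∀ k : ℕ, KillsExt b i (ModuleCat.of R (ker (lsmul R M (x ^ k)))) N)
    (hC : ∀ k : ℕ, KillsExt b (i + 1) (ModuleCat.of R (M ⧸ range (lsmul R M (x ^ k)))) N) :
    KillsExt (b ^ 2) i M N := by
  intro e
  have : Module.Finite R M := hM
  have : Module.Finite R N := hN
  refine smul_eq_zero_of_forall_exists_pow_smul hx fun k ↦ ?_
  obtain ⟨B, p, j, h₁, h₂, hpj, hS₁, hS₂⟩ := exists_shortExact_lsmul M (x ^ k)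
  obtain ⟨v, hv⟩ := Ext.contravariant_sequence_exact₂ hS₁ N (b • e) (by
    rw [Ext.comp_smul, hK])
  obtain ⟨w, hw⟩ := Ext.contravariant_sequence_exact₁ hS₂ N (b • v) (add_comm 1 i) (by
    rw [Ext.comp_smul, hC])
  refine ⟨w, ?_⟩
  dsimp only at v hv w hw
  rw [pow_two, mul_smul, ← hv, ← Ext.comp_smul, ← hw, Ext.mk₀_comp_mk₀_assoc, hpj, Ext.mk₀_smul,
    Ext.smul_comp, Ext.mk₀_id_comp]

theorem KillsExt.sq_of_forall_pow_right {M N : ModuleCat.{u} R} (hM : fgMod R M) (hN : fgMod R N)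
    {x b : R} (hx : x ∈ maximalIdeal R) {i : ℕ}
    (hK : ∀ k : ℕ, KillsExt b (i + 1) M (ModuleCat.of R (ker (lsmul R N (x ^ k)))))
    (hC : ∀ k : ℕ, KillsExt b i M (ModuleCat.of R (N ⧸ range (lsmul R N (x ^ k))))) :
    KillsExt (b ^ 2) i M N := by
  intro e
  have : Module.Finite R M := hM
  have : Module.Finite R N := hN
  refine smul_eq_zero_of_forall_exists_pow_smul hx fun k ↦ ?_
  obtain ⟨B, p, j, h₁, h₂, hpj, hS₁, hS₂⟩ := exists_shortExact_lsmul N (x ^ k)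
  obtain ⟨v, hv⟩ := Ext.covariant_sequence_exact₂ M hS₂ (b • e) (by
    rw [Ext.smul_comp, hC])
  obtain ⟨w, hw⟩ := Ext.covariant_sequence_exact₃ M hS₁ (b • v) rfl (by
    rw [Ext.smul_comp, hK])
  refine ⟨w, ?_⟩
  dsimp only at v hv w hw
  rw [pow_two, mul_smul, ← hv, ← Ext.smul_comp, ← hw, Ext.comp_assoc_of_third_deg_zero,
    Ext.mk₀_comp_mk₀, hpj, Ext.mk₀_smul, Ext.comp_smul, Ext.comp_mk₀_id]

end SyzygyAnn

/-! ### The finite length case and the conclusion. -/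

namespace SyzygyAnn

open LinearMap IsLocalRing Abelian

variable {R : Type u} [CommRing R]

theorem mem_annTor_iff {P Q : ObjectProperty (ModuleCat.{u} R)} {a : R} :
    a ∈ annTor P Q ↔ ∀ X, P X → ∀ Y, Q Y → ∀ i, 0 < i → KillsTor a i X Y := by
  simp only [annTor, Submodule.mem_iInf, Module.mem_annihilator, KillsTor]

theorem mem_annExt_iff {P Q : ObjectProperty (ModuleCat.{u} R)} {a : R} :
    a ∈ annExt P Q ↔ ∀ X, P X → ∀ Y, Q Y → ∀ i, 0 < i → KillsExt a i X Y := by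
  simp only [annExt, Submodule.mem_iInf, Module.mem_annihilator, KillsExt]

variable [IsNoetherianRing R]

theorem exists_syz_forall_killsTor (n : ℕ) (X : ModuleCat.{u} R) (hX : fl R X) :
    ∃ M : ModuleCat.{u} R, syz n (fl R) M ∧ ∀ (b : R) (Y : ModuleCat.{u} R) (i : ℕ), 0 < i →
      KillsTor b i M Y → KillsTor b (i + n) X Y := by
  obtain ⟨M, hM, hMX, H⟩ := exists_isSyzygy n X (fgMod_of_fl hX)
  refine ⟨M, ⟨hM, X, hX, hMX⟩, fun b Y i hi h ↦ ?_⟩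
  obtain ⟨i, rfl⟩ := Nat.exists_eq_succ_of_ne_zero hi.ne'
  -- The index is offset by one because the shift for Tor starts in degree 1.
  have := H (fun i X ↦ KillsTor b (i + 1) X Y) (fun i k K Z f g hf hg hfg h ↦ by
    have : Module.Flat R (ModuleCat.of R (Fin k → R)) :=
      inferInstanceAs (Module.Flat R (Fin k → R))
    exact h.of_syzygy hf hg hfg) i h
  rwa [add_right_comm] at this

theorem exists_syz_forall_killsExt (n : ℕ) (X : ModuleCat.{u} R) (hX : fl R X) :
    ∃ M : ModuleCat.{u} R, syz n (fl R) M ∧ ∀ (b : R) (Y : ModuleCat.{u} R) (i : ℕ),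
      KillsExt b i M Y → KillsExt b (i + n) X Y := by
  obtain ⟨M, hM, hMX, H⟩ := exists_isSyzygy n X (fgMod_of_fl hX)
  exact ⟨M, ⟨hM, X, hX, hMX⟩, fun b Y ↦ H (fun i X ↦ KillsExt b i X Y)
    fun i k K Z f g hf hg hfg h ↦ h.of_syzygy hf hg hfg⟩

theorem killsTor_of_fl {m n : ℕ} {a : R} (ha : a ∈ annTor (syz m (fl R)) (syz n (fl R)))
    {X Y : ModuleCat.{u} R} (hX : fl R X) (hY : fl R Y) {i : ℕ} (hi : m + n < i) :
    KillsTor a i X Y := by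
  obtain ⟨j, rfl⟩ := Nat.exists_eq_add_of_lt hi
  obtain ⟨M, hM, HM⟩ := exists_syz_forall_killsTor m X hX
  obtain ⟨N, hN, HN⟩ := exists_syz_forall_killsTor n Y hY
  have h := (HN a M _ j.succ_pos (mem_annTor_iff.1 ha M hM N hN _ j.succ_pos).symm)
  have h' := HM a Y (j + 1 + n) (by omega) (by
    rw [Nat.succ_add, Nat.succ_eq_add_one] at h
    rw [add_right_comm]
    exact h.symm)
  rwa [show m + n + j + 1 = j + 1 + n + m by omega]

theorem killsExt_of_fl {m n : ℕ} {a : R} (ha : a ∈ annExt (syz m (fl R)) (syz n (fl R)))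
    {X Y : ModuleCat.{u} R} (hX : fl R X) (hY : fl R Y) {i : ℕ} (hi : m < i) :
    KillsExt (a ^ (n + 1)) i X Y := by
  obtain ⟨M, hM, HM⟩ := exists_syz_forall_killsExt m X hX
  have key : ∀ N, syz n (fl R) N → ∀ i, m < i → KillsExt a i X N := by
    intro N hN i hi
    obtain ⟨j, rfl⟩ := Nat.exists_eq_add_of_lt hi
    rw [add_assoc, add_comm]
    exact HM a N (j + 1) (mem_annExt_iff.1 ha M hM N hN _ j.succ_pos)
  -- For `n = 0` no free module intervenes, and `R` need not have finite length.
  cases n with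
  | zero =>
    rw [zero_add, pow_one]
    exact key Y ⟨fgMod_of_fl hY, Y, hY, isSyzygy_zero Y⟩ i hi
  | succ n =>
    obtain ⟨N, hN, hNY, H⟩ := exists_isSyzygy (n + 1) Y (fgMod_of_fl hY)
    have := H (fun r Y ↦ ∀ i, m < i → KillsExt (a ^ (r + 1)) i X Y)
      (fun r k K Z f g hf hg hfg h i hi ↦ by
        rw [pow_succ']
        exact .mul_of_exact hf hg hfg ((key _ (syz_self n) i hi).pi k) (h (i + 1) (by omega)))
      0 (fun i hi ↦ by
        rw [zero_add, pow_one]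
        exact key N ⟨hN, Y, hY, hNY⟩ i hi) i hi
    rwa [zero_add] at this

variable [IsLocalRing R]

/-- Each parameter raises the degree bound by one, because the kernel is used one degree lower. -/
theorem killsTor_of_forall_fl {d : ℕ} (hd : ringKrullDim R = d) {N : ModuleCat.{u} R}
    (hN : fgMod R N) {c : ℕ} {a : R}
    (h : ∀ X : ModuleCat.{u} R, fl R X → ∀ i, c < i → KillsTor a i X N)
    {M : ModuleCat.{u} R} (hM : fgMod R M) {i : ℕ} (hi : c + d < i) :
    KillsTor (a ^ 2 ^ d) i M N := by
  refine induction_systemOfParameters hd (fun r b M ↦ ∀ i, c + r < i → KillsTor b i M N) h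
    (fun r b M hM x hx hK hC i hi ↦ ?_) M hM i hi
  obtain ⟨j, rfl⟩ := Nat.exists_eq_add_of_lt hi
  rw [show c + (r + 1) + j + 1 = c + r + j + 2 by omega]
  exact .sq_of_forall_pow (i := c + r + j) hM hN hx (fun k ↦ hK k _ (by omega))
    (fun k ↦ hC k _ (by omega))

end SyzygyAnn

theorem proposition3p5 {R : Type u} [CommRing R] [IsLocalRing R] [IsNoetherianRing R]
    (d : ℕ) (hd : ringKrullDim R = d) (m n : ℕ) (a : R) :
    (a ∈ SyzygyAnn.annTor (SyzygyAnn.syz m (SyzygyAnn.fl R)) (SyzygyAnn.syz n (SyzygyAnn.fl R)) →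
      ∀ i : ℕ, m + n + 2 * d < i →
        ∀ M N : ModuleCat.{u} R, SyzygyAnn.fgMod R M → SyzygyAnn.fgMod R N →
          ∀ t : ((Tor (ModuleCat.{u} R) i).obj M).obj N, a ^ (2 ^ (2 * d)) • t = 0) ∧
    (a ∈ SyzygyAnn.annExt (SyzygyAnn.syz m (SyzygyAnn.fl R)) (SyzygyAnn.syz n (SyzygyAnn.fl R)) →
      ∀ i : ℕ, m < i →
        ∀ M N : ModuleCat.{u} R, SyzygyAnn.fgMod R M → SyzygyAnn.fgMod R N →
          ∀ e : Abelian.Ext.{u} M N i, a ^ (2 ^ (2 * d) * (n + 1)) • e = 0) := by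
  refine ⟨fun ha i hi M N hM hN ↦ ?_, fun ha i hi M N hM hN ↦ ?_⟩
  -- One variable is made arbitrary while the other has finite length; symmetry then allows the same
  -- reduction in the other.
  · have h (Y : ModuleCat.{u} R) (hY : SyzygyAnn.fl R Y) (i : ℕ) (hi : m + n + d < i) :
        SyzygyAnn.KillsTor (a ^ 2 ^ d) i Y M := by
      obtain ⟨j, rfl⟩ := Nat.exists_eq_add_of_lt hi
      exact (SyzygyAnn.killsTor_of_forall_fl hd (SyzygyAnn.fgMod_of_fl hY)
        (fun X hX i hi ↦ SyzygyAnn.killsTor_of_fl ha hX hY hi) hM hi).symm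
    obtain ⟨j, rfl⟩ := Nat.exists_eq_add_of_lt hi
    have := (SyzygyAnn.killsTor_of_forall_fl (i := m + n + 2 * d + j + 1) hd hM h hN
      (by omega)).symm
    rwa [← pow_mul, ← pow_add, ← two_mul] at this
  · have h (Y : ModuleCat.{u} R) (hY : SyzygyAnn.fl R Y) :
        ∀ i, m < i → SyzygyAnn.KillsExt ((a ^ (n + 1)) ^ 2 ^ d) i M Y :=
      SyzygyAnn.induction_systemOfParameters hd
        (fun _ b M ↦ ∀ i, m < i → SyzygyAnn.KillsExt b i M Y)
        (fun X hX i hi ↦ SyzygyAnn.killsExt_of_fl ha hX hY hi)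
        (fun r b M hM x hx hK hC i hi ↦ .sq_of_forall_pow_left hM (SyzygyAnn.fgMod_of_fl hY) hx
          (fun k ↦ hK k i hi) fun k ↦ hC k (i + 1) (by omega)) M hM
    have := SyzygyAnn.induction_systemOfParameters hd
      (fun _ b N ↦ ∀ i, m < i → SyzygyAnn.KillsExt b i M N) h
      (fun r b N hN x hx hK hC i hi ↦ .sq_of_forall_pow_right hM hN hx
        (fun k ↦ hK k (i + 1) (by omega)) fun k ↦ hC k i hi) N hN i hi
    rwa [← pow_mul, ← pow_mul, ← pow_add, ← two_mul, mul_comm] at this
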